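/- Let $\Omega=\Omega_1\times\dots\times\Omega_d$, where each $\Omega_i\subset\mathbb R$ is a (possibly unbounded) interval symmetric about $0$, and let $\rho(\mathbf x)=\rho_1(x_1)\cdots\rho_d(x_d)$, where each weight $\rho_i:\Omega_i\to[0,\infty)$ is even ($\rho_i(-x)=\rho_i(x)$) and $\int_{\Omega_i}|x|^m\rho_i(x)\,dx<\infty$ for all integers $m\ge 0$. Put $I_d^\rho(f)=\int_\Omega f(\mathbf x)\rho(\mathbf x)\,d\mathbf x$. A cubature formula with $n$ points is a functional $Q_n(f)=\sum_{i=1}^n a_i f(\mathbf x_i)$ with coefficients $a_i\in\mathbb R$ and knots $\mathbf x_i\in\Omega$; it has degree $\ell$ of exactness for $I_d^\rho$ if $Q_n(f)=I_d^\rho(f)$ for every real polynomial $f$ in $d$ variables of total degree at most $\ell$. Let $k\in\{2,3\}$, and assume $d\ge 4$ if $k=2$ and $d\ge 6$ if $k=3$. Then there is a cubature formula $Q_n$ with degree $2k+1$ of exactness for $I_d^\rho$ that uses at most $$d^2+9d+1 \quad (k=2),\qquad \frac{d^3+33d^2+14d+3}{3}\quad (k=3)$$ points. If the one-dimensional weights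 are all equal ($\Omega_1=\dots=\Omega_d$ and $\rho_1=\dots=\rho_d$), then there is such a formula with at most $$d^2+7d+1 \quad (k=2),\qquad \frac{d^3+21d^2+20d+3}{3}\quad (k=3)$$ points. -/

import Mathlib

open MeasureTheory

/-- A product weight on `Ω = Ω₁ × ⋯ × Ω_d`: each `Ωᵢ ⊆ ℝ` is a (possibly unbounded) interval
symmetric about `0`, and each one-dimensional weight `ρᵢ : Ωᵢ → [0, ∞)` is even and makes all
univariate polynomials integrable. Only the values of `weight i` on `dom i` matter. -/
structure SymmetricProductWeight (d : ℕ) where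
  /-- the intervals `Ωᵢ` -/
  dom : Fin d → Set ℝ
  /-- the one-dimensional weight functions `ρᵢ` -/
  weight : Fin d → ℝ → ℝ
  dom_interval : ∀ i, (dom i).OrdConnected
  dom_symm : ∀ i, ∀ x ∈ dom i, -x ∈ dom i
  weight_nonneg : ∀ i, ∀ x ∈ dom i, 0 ≤ weight i x
  weight_symm : ∀ i, ∀ x ∈ dom i, weight i (-x) = weight i x
  weight_integrable : ∀ i, ∀ m : ℕ, IntegrableOn (fun x : ℝ => x ^ m * weight i x) (dom i)

namespace SymmetricProductWeight

variable {d : ℕ}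

/-- The domain `Ω = Ω₁ × ⋯ × Ω_d`. -/
def domain (W : SymmetricProductWeight d) : Set (Fin d → ℝ) :=
  {x | ∀ i, x i ∈ W.dom i}

/-- The product weight `ρ(x) = ρ₁(x₁) ⋯ ρ_d(x_d)`. -/
def density (W : SymmetricProductWeight d) (x : Fin d → ℝ) : ℝ :=
  ∏ i, W.weight i (x i)

/-- The functional `f ↦ ∫_Ω f(x) ρ(x) dx` (with respect to Lebesgue measure). -/
noncomputable def integral (W : SymmetricProductWeight d) (f : (Fin d → ℝ) → ℝ) : ℝ :=
  ∫ x in W.domain, f x * W.density x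

/-- The fully symmetric case: all the one-dimensional weight functions `ρᵢ : Ωᵢ → [0, ∞)`
are the same function (on the same interval). -/
def FullySymmetric (W : SymmetricProductWeight d) : Prop :=
  ∀ i j, W.dom i = W.dom j ∧ Set.EqOn (W.weight i) (W.weight j) (W.dom i)

end SymmetricProductWeight

/-- A cubature formula with `n` knots, all of them in `Ω`, and arbitrary real coefficients. -/
structure CubatureFormula {d : ℕ} (Ω : Set (Fin d → ℝ)) (n : ℕ) where
  /-- the coefficients `aᵢ` -/
  coeff : Fin n → ℝ
  /-- the knots `xᵢ` -/
  knot : Fin n → Fin d → ℝ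
  knot_mem : ∀ i, knot i ∈ Ω

namespace CubatureFormula

variable {d n : ℕ}

/-- The functional `f ↦ ∑ aᵢ f(xᵢ)`. -/
def apply {Ω : Set (Fin d → ℝ)} (Q : CubatureFormula Ω n) (f : (Fin d → ℝ) → ℝ) : ℝ :=
  ∑ i, Q.coeff i * f (Q.knot i)

/-- `Q` has degree `l` of exactness for the weight `W`: it integrates every polynomial in `d`
variables of total degree at most `l` exactly. -/
def HasExactness {W : SymmetricProductWeight d} (Q : CubatureFormula W.domain n) (l : ℕ) : Prop :=
  ∀ p : MvPolynomial (Fin d) ℝ, p.totalDegree ≤ l →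
    Q.apply (fun x => MvPolynomial.eval x p) = W.integral (fun x => MvPolynomial.eval x p)

end CubatureFormula

/-- `V` is the table of monomial moments of a linear combination of at most `n` point evaluations
in `B`. -/
def IsMomentTable {d : ℕ} (B : Set (Fin d → ℝ)) (n : ℕ) (V : (Fin d → ℕ) → ℝ) : Prop :=
  ∃ (ι : Type) (_ : Fintype ι) (w : ι → ℝ) (y : ι → Fin d → ℝ),
    Fintype.card ι ≤ n ∧ (∀ i, y i ∈ B) ∧ ∀ s, V s = ∑ i, w i * ∏ j, y i j ^ s j

namespace IsMomentTable

variable {d n m : ℕ} {B : Set (Fin d → ℝ)} {V V' : (Fin d → ℕ) → ℝ}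

theorem mono (h : IsMomentTable B n V) (hnm : n ≤ m) : IsMomentTable B m V := by
  obtain ⟨ι, hι, w, y, h1, h2, h3⟩ := h
  exact ⟨ι, hι, w, y, h1.trans hnm, h2, h3⟩

theorem zero : IsMomentTable B 0 (fun _ => 0) :=
  ⟨Empty, inferInstance, Empty.elim, fun e => e.elim, by simp, by simp, by simp⟩

theorem add (h : IsMomentTable B n V) (h' : IsMomentTable B m V') :
    IsMomentTable B (n + m) (fun s => V s + V' s) := by
  obtain ⟨ι, hι, w, y, h1, h2, h3⟩ := h
  obtain ⟨κ, hκ, w', y', h1', h2', h3'⟩ := h'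
  refine ⟨ι ⊕ κ, inferInstance, Sum.elim w w', Sum.elim y y', ?_, ?_, fun s => ?_⟩
  · rw [Fintype.card_sum]; omega
  · rintro (i | i)
    exacts [h2 i, h2' i]
  · simp [h3, h3', Fintype.sum_sum_type]

theorem smul (c : ℝ) (h : IsMomentTable B n V) : IsMomentTable B n (fun s => c * V s) := by
  obtain ⟨ι, hι, w, y, h1, h2, h3⟩ := h
  exact ⟨ι, hι, fun i => c * w i, y, h1, h2, fun s => by simp [h3, Finset.mul_sum, mul_assoc]⟩

theorem sum {α : Type*} (A : Finset α) {F : α → (Fin d → ℕ) → ℝ}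
    (h : ∀ a ∈ A, IsMomentTable B m (F a)) :
    IsMomentTable B (A.card * m) (fun s => ∑ a ∈ A, F a s) := by
  classical
  induction A using Finset.induction_on with
  | empty => simpa using zero
  | insert a A ha ih =>
    have := (h a (by simp)).add (ih fun b hb => h b (by simp [hb]))
    simp only [Finset.sum_insert ha, Finset.card_insert_of_notMem ha]
    exact this.mono (by rw [add_mul]; omega)

theorem finset (P : Finset (Fin d → ℝ)) (hP : ∀ y ∈ P, y ∈ B) :
    IsMomentTable B P.card (fun s => ∑ y ∈ P, ∏ j, y j ^ s j) := by
  have := sum (B := B) (m := 1) P (F := fun y s => ∏ j, y j ^ s j) fun y hy =>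
    ⟨Unit, inferInstance, fun _ => 1, fun _ => y, by simp, fun _ => hP y hy, by simp⟩
  simpa using this

/-- Averaging over the reflections in the coordinates of `S` of a point supported on `S`. -/
theorem reflections (S : Finset (Fin d)) (x : Fin d → ℝ) (hx : ∀ l ∈ S, x l ≠ 0)
    (hB : ∀ y : Fin d → ℝ, (∀ l, |y l| ≤ |x l|) → y ∈ B) :
    IsMomentTable B (2 ^ S.card) (fun s =>
      ∏ l, if l ∈ S then (if Even (s l) then x l ^ s l else 0) else 0 ^ s l) := by
  classical
  set t : Fin d → Finset ℝ := fun l => if l ∈ S then {x l, -x l} else {0} with ht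
  have hcard : (Fintype.piFinset t).card = 2 ^ S.card := by
    rw [Fintype.card_piFinset, ← Finset.prod_const, ← Finset.prod_subset (Finset.subset_univ S)]
    · refine Finset.prod_congr rfl fun l hl => ?_
      have : x l ≠ -x l := fun h => hx l hl (by linarith)
      simp [ht, hl, Finset.card_pair this]
    · intro l _ hl
      simp [ht, hl]
  have h := (finset (B := B) (Fintype.piFinset t) fun y hy => hB y fun l => by
    have := Fintype.mem_piFinset.1 hy l
    by_cases hl : l ∈ S
    · simp only [ht, hl, if_true, Finset.mem_insert, Finset.mem_singleton] at this
      rcases this with h | h <;> simp [h]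
    · simp only [ht, hl, if_false, Finset.mem_singleton] at this
      simp [this]).smul ((1 / 2 : ℝ) ^ S.card)
  rw [hcard] at h
  convert h using 2 with s
  rw [← Finset.prod_univ_sum t fun j v => v ^ s j, ← Finset.prod_const,
    ← Fintype.prod_ite_mem S, ← Finset.prod_mul_distrib]
  refine Finset.prod_congr rfl fun l _ => ?_
  by_cases hl : l ∈ S
  · have hne : x l ≠ -x l := fun h => hx l hl (by linarith)
    simp only [ht, hl, if_true, Finset.sum_pair hne]
    by_cases he : Even (s l)
    · rw [he.neg_pow, if_pos he]; ring
    · rw [(Nat.not_even_iff_odd.1 he).neg_pow, if_neg he]; ring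
  · simp [ht, hl]

theorem evenReflections (S : Finset (Fin d)) (x : Fin d → ℝ) (hx : ∀ l ∈ S, x l ≠ 0)
    (hB : ∀ y : Fin d → ℝ, (∀ l, |y l| ≤ |x l|) → y ∈ B) :
    IsMomentTable B (2 ^ S.card) (fun s =>
      if (∀ i, Even (s i)) ∧ ∀ i, s i ≠ 0 → i ∈ S then ∏ l ∈ S, x l ^ s l else 0) := by
  convert reflections S x hx hB using 2 with s
  split_ifs with h
  · rw [← Fintype.prod_ite_mem S]
    refine Finset.prod_congr rfl fun l _ => ?_
    by_cases hl : l ∈ S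
    · simp [hl, h.1 l]
    · have : s l = 0 := by_contra fun h0 => hl (h.2 l h0)
      simp [hl, this]
  · symm
    rw [Finset.prod_eq_zero_iff]
    by_contra! h0
    refine h ⟨fun i => ?_, fun i hi => ?_⟩
    · by_contra he
      have := h0 i (Finset.mem_univ i)
      have hs : s i ≠ 0 := fun h => he (by simp [h])
      by_cases hi : i ∈ S <;> simp [hi, he, hs] at this
    · by_contra hiS
      have := h0 i (Finset.mem_univ i)
      simp [hi, hiS] at this

/-- Averaging a point and its antipode. -/
theorem antipodal (x : Fin d → ℝ) (hx : x ∈ B) (hx' : -x ∈ B) :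
    IsMomentTable B 2 (fun s => if Even (∑ j, s j) then ∏ j, x j ^ s j else 0) := by
  refine ⟨Bool, inferInstance, fun _ => 1 / 2, fun b => if b then x else -x, by simp, ?_,
    fun s => ?_⟩
  · rintro (_ | _) <;> simpa
  · have : ∏ j, (-x) j ^ s j = (-1) ^ (∑ j, s j) * ∏ j, x j ^ s j := by
      rw [← Finset.prod_pow_eq_pow_sum, ← Finset.prod_mul_distrib]
      exact Finset.prod_congr rfl fun j _ => by rw [Pi.neg_apply, neg_pow]
    simp only [Fintype.sum_bool, if_true, Bool.false_eq_true, if_false, this]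
    split_ifs with h
    · rw [h.neg_one_pow]; ring
    · rw [(Nat.not_even_iff_odd.1 h).neg_one_pow]; ring

end IsMomentTable

/-- The table `V` agrees with `T` in degrees at most `D`, on all monomials that are odd in some
variable or involve at least `r` variables. -/
def AgreesFrom {d : ℕ} (D r : ℕ) (T V : (Fin d → ℕ) → ℝ) : Prop :=
  ∀ s : Fin d → ℕ, ∑ i, s i ≤ D →
    ((∃ i, Odd (s i)) ∨ r ≤ (Finset.univ.filter fun i => s i ≠ 0).card) → V s = T s

/-- Corrections on the `r`-dimensional coordinate planes. -/
theorem AgreesFrom.descend {d D r n m : ℕ} {B : Set (Fin d → ℝ)} {T V : (Fin d → ℕ) → ℝ}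
    (hV : IsMomentTable B n V) (hT : AgreesFrom D (r + 1) T V)
    (hC : ∀ (R : (Fin d → ℕ) → ℝ) (S : Finset (Fin d)), S.card = r →
      ∃ C, IsMomentTable B m C ∧
        (∀ s, C s ≠ 0 → (∀ i, Even (s i)) ∧ ∀ i, s i ≠ 0 → i ∈ S) ∧
        ∀ s : Fin d → ℕ, ∑ i, s i ≤ D → (∀ i, Even (s i)) → (∀ i, s i ≠ 0 ↔ i ∈ S) →
          C s = R s) :
    ∃ V', IsMomentTable B (n + d.choose r * m) V' ∧ AgreesFrom D r T V' := by
  classical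
  choose! C h1 h2 h3 using hC (fun s => T s - V s)
  refine ⟨fun s => V s + ∑ S ∈ Finset.powersetCard r Finset.univ, C S s, ?_, ?_⟩
  · refine hV.add ?_
    have := IsMomentTable.sum (B := B) (m := m) (Finset.powersetCard r Finset.univ) (F := C)
      fun S hS => h1 S (Finset.mem_powersetCard.1 hS).2
    simpa using this
  · intro s hs hor
    set P := Finset.univ.filter fun i => s i ≠ 0 with hP
    have hzero : ∀ S ∈ Finset.powersetCard r Finset.univ, S ≠ P → C S s = 0 := by
      intro S hS hne
      by_contra h0
      have hc := (Finset.mem_powersetCard.1 hS).2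
      obtain ⟨he, hsub⟩ := h2 S hc s h0
      have hPS : P ⊆ S := fun i hi => hsub i (by simpa [hP] using hi)
      have hr : r ≤ P.card := by
        rcases hor with ⟨i, hi⟩ | h
        · exact absurd (he i) (Nat.not_even_iff_odd.2 hi)
        · exact h
      exact hne (Finset.eq_of_subset_of_card_le hPS (by omega)).symm
    beta_reduce
    by_cases hodd : ∃ i, Odd (s i)
    · rw [Finset.sum_eq_zero, add_zero]
      · exact hT s hs (Or.inl hodd)
      · intro S hS
        by_contra h0
        obtain ⟨i, hi⟩ := hodd
        exact Nat.not_even_iff_odd.2 hi ((h2 S (Finset.mem_powersetCard.1 hS).2 s h0).1 i)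
    · have hr : r ≤ P.card := hor.resolve_left hodd
      rcases hr.eq_or_lt with hr | hr
      · have hmem : P ∈ Finset.powersetCard r Finset.univ := by
          simp [Finset.mem_powersetCard, hr]
        rw [Finset.sum_eq_single_of_mem P hmem hzero, h3 P hr.symm s hs
          (fun i => Nat.not_odd_iff_even.1 fun h => hodd ⟨i, h⟩) (by simp [hP])]
        ring
      · rw [Finset.sum_eq_zero, add_zero]
        · exact hT s hs (Or.inr hr)
        · intro S hS
          refine hzero S hS fun h => ?_
          have := (Finset.mem_powersetCard.1 hS).2
          rw [h] at this
          omega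

/-- The cube `[-c, c]^d`. -/
def cube (d : ℕ) (c : ℝ) : Set (Fin d → ℝ) := {x | ∀ i, |x i| ≤ c}

theorem sum_powersetCard_insert {α : Type*} [DecidableEq α] {A : Finset α} {a : α} (ha : a ∉ A)
    (r : ℕ) (y : α → ℝ) :
    ∑ S ∈ Finset.powersetCard (r + 1) (insert a A), ∏ i ∈ S, y i
      = ∑ S ∈ Finset.powersetCard (r + 1) A, ∏ i ∈ S, y i
        + y a * ∑ S ∈ Finset.powersetCard r A, ∏ i ∈ S, y i := by
  rw [Finset.powersetCard_succ_insert ha, Finset.sum_union, Finset.sum_image, Finset.mul_sum]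
  · exact congrArg _ (Finset.sum_congr rfl fun S hS =>
      Finset.prod_insert fun h => ha ((Finset.mem_powersetCard.1 hS).1 h))
  · intro S hS T hT h
    have h1 : a ∉ S := fun h => ha ((Finset.mem_powersetCard.1 hS).1 h)
    have h2 : a ∉ T := fun h => ha ((Finset.mem_powersetCard.1 hT).1 h)
    rw [← Finset.erase_insert h1, ← Finset.erase_insert h2]
    exact congrArg (fun U => U.erase a) h
  · refine Finset.disjoint_left.2 fun S hS hS' => ?_
    obtain ⟨T, -, rfl⟩ := Finset.mem_image.1 hS'
    exact ha ((Finset.mem_powersetCard.1 hS).1 (Finset.mem_insert_self a T))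

theorem sum_powersetCard_two {α : Type*} [DecidableEq α] (A : Finset α) (y : α → ℝ) :
    ∑ S ∈ Finset.powersetCard 2 A, ∏ i ∈ S, y i
      = ((∑ i ∈ A, y i) ^ 2 - ∑ i ∈ A, y i ^ 2) / 2 := by
  induction A using Finset.induction_on with
  | empty => rw [Finset.powersetCard_eq_empty.2 (by simp)]; simp
  | insert a A ha ih =>
    rw [sum_powersetCard_insert ha, ih, Finset.powersetCard_one, Finset.sum_map]
    simp only [Finset.sum_insert ha, Function.Embedding.coeFn_mk, Finset.prod_singleton]
    ring

theorem sum_powersetCard_three {α : Type*} [DecidableEq α] (A : Finset α) (y : α → ℝ) :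
    ∑ S ∈ Finset.powersetCard 3 A, ∏ i ∈ S, y i
      = ((∑ i ∈ A, y i) ^ 3 - 3 * (∑ i ∈ A, y i) * ∑ i ∈ A, y i ^ 2
          + 2 * ∑ i ∈ A, y i ^ 3) / 6 := by
  induction A using Finset.induction_on with
  | empty => rw [Finset.powersetCard_eq_empty.2 (by simp)]; simp
  | insert a A ha ih =>
    rw [sum_powersetCard_insert ha, ih, sum_powersetCard_two]
    simp only [Finset.sum_insert ha]
    ring

/-- The points `±(1 - 2 e_S)` with `|S| = r`. -/
theorem isMomentTable_flips {d : ℕ} {c : ℝ} (hc : 1 ≤ c) (r : ℕ) :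
    IsMomentTable (cube d c) (d.choose r * 2) (fun s =>
      ∑ S ∈ Finset.powersetCard r Finset.univ,
        if Even (∑ j, s j) then ∏ i ∈ S, (-1 : ℝ) ^ s i else 0) := by
  classical
  have := IsMomentTable.sum (B := cube d c) (m := 2) (Finset.powersetCard r Finset.univ)
    (F := fun S s => if Even (∑ j, s j) then ∏ i ∈ S, (-1 : ℝ) ^ s i else 0) fun S _ => by
      convert IsMomentTable.antipodal (B := cube d c) (fun i => if i ∈ S then (-1 : ℝ) else 1)
        (fun i => ?_) (fun i => ?_) using 3 with s
      · rw [← Fintype.prod_ite_mem S]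
        refine Finset.prod_congr rfl fun i _ => ?_
        split_ifs <;> simp
      · beta_reduce
        split_ifs <;> simpa
      · rw [Pi.neg_apply]
        split_ifs <;> simpa
  simpa using this

theorem sum_neg_one_pow {d : ℕ} (s : Fin d → ℕ) :
    ∑ i, (-1 : ℝ) ^ s i = d - 2 * (Finset.univ.filter fun i => Odd (s i)).card := by
  have : ∀ i, (-1 : ℝ) ^ s i = 1 - 2 * if Odd (s i) then 1 else 0 := fun i => by
    split_ifs with h
    · rw [h.neg_one_pow]; ring
    · rw [(Nat.not_odd_iff_even.1 h).neg_one_pow]; ring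
  simp only [this, Finset.sum_sub_distrib, ← Finset.mul_sum, Finset.sum_boole]
  simp

/-- Points of `{-1, 1}^d` that annihilate the characters of `2` and `4` coordinates. -/
theorem exists_hypercube_table_two (d : ℕ) {c : ℝ} (hc : 1 ≤ c) :
    ∃ V : (Fin d → ℕ) → ℝ, IsMomentTable (cube d c) (d.choose 2 * 2 + (d * 2 + 2)) V ∧
      ∀ s : Fin d → ℕ, ∑ i, s i ≤ 5 →
        ((∃ i, Odd (s i)) → V s = 0) ∧ ((∀ i, Even (s i)) → V s = 1) := by
  have h := (((isMomentTable_flips (d := d) hc 2)).add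
    (((isMomentTable_flips (d := d) hc 1).smul (-(d - 6 : ℝ))).add
    ((isMomentTable_flips (d := d) hc 0).smul ((d - 4 : ℝ) * (d - 8) / 2 + d / 2)))).smul (1 / 16)
  refine ⟨_, h.mono (by simp), fun s hs => ?_⟩
  have hsq : ∀ i, ((-1 : ℝ) ^ s i) ^ 2 = 1 := fun i => by rw [← pow_mul, mul_comm, pow_mul]; simp
  by_cases he : Even (∑ j, s j)
  · simp only [he, if_true, Finset.powersetCard_one, Finset.powersetCard_zero, Finset.sum_map,
      sum_powersetCard_two, hsq, Finset.sum_singleton, Finset.prod_empty,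
      Function.Embedding.coeFn_mk, Finset.prod_singleton, sum_neg_one_pow]
    have hcard := (Finset.even_sum_iff_even_card_odd s).1 he
    have hle : (Finset.univ.filter fun i => Odd (s i)).card ≤ 5 := by
      refine le_trans ?_ hs
      rw [Finset.card_eq_sum_ones]
      refine (Finset.sum_le_sum fun i hi => ?_).trans
        (Finset.sum_le_sum_of_subset (Finset.filter_subset _ _))
      exact (Finset.mem_filter.1 hi).2.pos
    constructor
    · rintro ⟨i, hi⟩
      have hpos : 0 < (Finset.univ.filter fun i => Odd (s i)).card :=
        Finset.card_pos.2 ⟨i, by simpa using hi⟩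
      generalize (Finset.univ.filter fun i => Odd (s i)).card = o at *
      interval_cases o
      · exact absurd hcard (by decide)
      · simp; ring
      · exact absurd hcard (by decide)
      · simp; ring
      · exact absurd hcard (by decide)
    · intro hall
      have : (Finset.univ.filter fun i => Odd (s i)) = ∅ := by
        simp [Finset.filter_eq_empty_iff, hall]
      simp [this]; ring
  · refine ⟨fun _ => by simp [he], fun h => absurd (Finset.even_sum _ fun i _ => h i) he⟩

/-- Points of `{-1, 1}^d` that annihilate the characters of `2`, `4` and `6` coordinates. -/
theorem exists_hypercube_table_three (d : ℕ) {c : ℝ} (hc : 1 ≤ c) :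
    ∃ V : (Fin d → ℕ) → ℝ,
      IsMomentTable (cube d c) (d.choose 3 * 2 + (d.choose 2 * 2 + (d * 2 + 2))) V ∧
      ∀ s : Fin d → ℕ, ∑ i, s i ≤ 7 →
        ((∃ i, Odd (s i)) → V s = 0) ∧ ((∀ i, Even (s i)) → V s = 1) := by
  have h := ((isMomentTable_flips (d := d) hc 3).add
    (((isMomentTable_flips (d := d) hc 2).smul (-(d - 8 : ℝ))).add
    (((isMomentTable_flips (d := d) hc 1).smul ((3 * d ^ 2 - 45 * d + 174) / 6 : ℝ)).add
    ((isMomentTable_flips (d := d) hc 0).smul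
      (-((d - 4 : ℝ) * (d - 8) * (d - 12) / 6) - (d - 8) * d / 2))))).smul (1 / 64)
  refine ⟨_, h.mono (by simp), fun s hs => ?_⟩
  have hsq : ∀ i, ((-1 : ℝ) ^ s i) ^ 2 = 1 := fun i => by rw [← pow_mul, mul_comm, pow_mul]; simp
  have hcu : ∀ i, ((-1 : ℝ) ^ s i) ^ 3 = (-1 : ℝ) ^ s i := fun i => by
    rw [pow_succ, hsq, one_mul]
  by_cases he : Even (∑ j, s j)
  · simp only [he, if_true, Finset.powersetCard_one, Finset.powersetCard_zero, Finset.sum_map,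
      sum_powersetCard_two, sum_powersetCard_three, hsq, hcu, Finset.sum_singleton,
      Finset.prod_empty, Function.Embedding.coeFn_mk, Finset.prod_singleton, sum_neg_one_pow]
    have hcard := (Finset.even_sum_iff_even_card_odd s).1 he
    have hle : (Finset.univ.filter fun i => Odd (s i)).card ≤ 7 := by
      refine le_trans ?_ hs
      rw [Finset.card_eq_sum_ones]
      refine (Finset.sum_le_sum fun i hi => ?_).trans
        (Finset.sum_le_sum_of_subset (Finset.filter_subset _ _))
      exact (Finset.mem_filter.1 hi).2.pos
    constructor
    · rintro ⟨i, hi⟩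
      have hpos : 0 < (Finset.univ.filter fun i => Odd (s i)).card :=
        Finset.card_pos.2 ⟨i, by simpa using hi⟩
      generalize (Finset.univ.filter fun i => Odd (s i)).card = o at *
      interval_cases o
      · exact absurd hcard (by decide)
      · simp; ring
      · exact absurd hcard (by decide)
      · simp; ring
      · exact absurd hcard (by decide)
      · simp; ring
      · exact absurd hcard (by decide)
    · intro hall
      have : (Finset.univ.filter fun i => Odd (s i)) = ∅ := by
        simp [Finset.filter_eq_empty_iff, hall]
      simp [this]; ring
  · refine ⟨fun _ => by simp [he], fun h => absurd (Finset.even_sum _ fun i _ => h i) he⟩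

theorem cube_of_abs_le {d : ℕ} {c : ℝ} {x y : Fin d → ℝ} (hx : ∀ i, |x i| ≤ c)
    (h : ∀ i, |y i| ≤ |x i|) : y ∈ cube d c :=
  fun i => (h i).trans (hx i)

/-- One can correct the moment of degree `0` at the origin. -/
theorem exists_correction_origin {d D : ℕ} (R : (Fin d → ℕ) → ℝ) (S : Finset (Fin d))
    (hS : S.card = 0) :
    ∃ C, IsMomentTable (cube d 3) 1 C ∧
      (∀ s, C s ≠ 0 → (∀ i, Even (s i)) ∧ ∀ i, s i ≠ 0 → i ∈ S) ∧
      ∀ s : Fin d → ℕ, ∑ i, s i ≤ D → (∀ i, Even (s i)) → (∀ i, s i ≠ 0 ↔ i ∈ S) → C s = R s := by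
  obtain rfl := Finset.card_eq_zero.1 hS
  have h := (IsMomentTable.evenReflections (B := cube d 3) ∅ (fun _ => 0) (by simp)
    fun y => cube_of_abs_le (by simp)).smul (R 0)
  refine ⟨_, h.mono (by simp), fun s hs => ?_, fun s _ he hsupp => ?_⟩
  · by_contra h
    simp only [if_neg h] at hs
    simp at hs
  · have : s = 0 := funext fun i => by simpa using hsupp i
    subst this
    simp

theorem singleton_sum_eq {d : ℕ} {i : Fin d} {s : Fin d → ℕ}
    (h : ∀ l, s l ≠ 0 ↔ l ∈ ({i} : Finset (Fin d))) : ∑ l, s l = s i ∧ s = Pi.single i (s i) := by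
  have hs : s = Pi.single i (s i) := by
    funext l
    by_cases hl : l = i
    · subst hl; simp
    · rw [Pi.single_eq_of_ne hl]
      by_contra h0
      exact hl (by simpa using (h l).1 h0)
  refine ⟨?_, hs⟩
  conv_lhs => rw [hs]
  simp

/-- With four points on a coordinate axis one can correct the moments of degrees `2` and `4`. -/
theorem exists_correction_axis_two {d : ℕ} (R : (Fin d → ℕ) → ℝ) (S : Finset (Fin d))
    (hS : S.card = 1) :
    ∃ C, IsMomentTable (cube d 3) 4 C ∧
      (∀ s, C s ≠ 0 → (∀ i, Even (s i)) ∧ ∀ i, s i ≠ 0 → i ∈ S) ∧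
      ∀ s : Fin d → ℕ, ∑ i, s i ≤ 5 → (∀ i, Even (s i)) → (∀ i, s i ≠ 0 ↔ i ∈ S) → C s = R s := by
  obtain ⟨i, rfl⟩ := Finset.card_eq_one.1 hS
  have h (a : ℝ) (ha : a ≠ 0) (ha' : |a| ≤ 3) := IsMomentTable.evenReflections (B := cube d 3)
    {i} (fun _ => a) (by simp [ha]) fun y => cube_of_abs_le (by simp [ha'])
  set A := R (Pi.single i 2) with hA
  set B := R (Pi.single i 4) with hB
  refine ⟨_, (((h 1 (by norm_num) (by norm_num)).smul ((4 * A - B) / 3)).add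
    ((h 2 (by norm_num) (by norm_num)).smul ((B - A) / 12))).mono (by simp), fun s hs => ?_,
    fun s hsum he hsupp => ?_⟩
  · by_contra h
    simp only [if_neg h] at hs
    simp at hs
  · obtain ⟨h1, h2⟩ := singleton_sum_eq hsupp
    simp only [if_pos (show (∀ i, Even (s i)) ∧ _ from ⟨he, fun l => (hsupp l).1⟩),
      Finset.prod_singleton]
    have h3 : s i ≠ 0 := (hsupp i).2 (by simp)
    have h4 := he i
    rw [h2, Pi.single_eq_same]
    rw [h1] at hsum
    generalize s i = e at *
    have : e = 2 ∨ e = 4 := by rcases h4 with ⟨m, rfl⟩; omega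
    rcases this with rfl | rfl
    · rw [← hA]; ring
    · rw [← hB]; ring

/-- With six points on a coordinate axis one can correct the moments of degrees `2`, `4`, `6`. -/
theorem exists_correction_axis_three {d : ℕ} (R : (Fin d → ℕ) → ℝ) (S : Finset (Fin d))
    (hS : S.card = 1) :
    ∃ C, IsMomentTable (cube d 3) 6 C ∧
      (∀ s, C s ≠ 0 → (∀ i, Even (s i)) ∧ ∀ i, s i ≠ 0 → i ∈ S) ∧
      ∀ s : Fin d → ℕ, ∑ i, s i ≤ 7 → (∀ i, Even (s i)) → (∀ i, s i ≠ 0 ↔ i ∈ S) → C s = R s := by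
  obtain ⟨i, rfl⟩ := Finset.card_eq_one.1 hS
  have h (a : ℝ) (ha : a ≠ 0) (ha' : |a| ≤ 3) := IsMomentTable.evenReflections (B := cube d 3)
    {i} (fun _ => a) (by simp [ha]) fun y => cube_of_abs_le (by simp [ha'])
  set A := R (Pi.single i 2) with hA
  set B := R (Pi.single i 4) with hB
  set C := R (Pi.single i 6) with hC
  refine ⟨_, (((h 1 (by norm_num) (by norm_num)).smul ((36 * A - 13 * B + C) / 24)).add
    (((h 2 (by norm_num) (by norm_num)).smul ((-9 * A + 10 * B - C) / 60)).add
    ((h 3 (by norm_num) (by norm_num)).smul ((4 * A - 5 * B + C) / 360)))).mono (by simp),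
    fun s hs => ?_, fun s hsum he hsupp => ?_⟩
  · by_contra h
    simp only [if_neg h] at hs
    simp at hs
  · obtain ⟨h1, h2⟩ := singleton_sum_eq hsupp
    simp only [if_pos (show (∀ i, Even (s i)) ∧ _ from ⟨he, fun l => (hsupp l).1⟩),
      Finset.prod_singleton]
    have h3 : s i ≠ 0 := (hsupp i).2 (by simp)
    have h4 := he i
    rw [h2, Pi.single_eq_same]
    rw [h1] at hsum
    generalize s i = e at *
    have : e = 2 ∨ e = 4 ∨ e = 6 := by rcases h4 with ⟨m, rfl⟩; omega
    rcases this with rfl | rfl | rfl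
    · rw [← hA]; ring
    · rw [← hB]; ring
    · rw [← hC]; ring

theorem pair_sum_eq {d : ℕ} {i j : Fin d} (hij : i ≠ j) {s : Fin d → ℕ}
    (h : ∀ l, s l ≠ 0 ↔ l ∈ ({i, j} : Finset (Fin d))) :
    ∑ l, s l = s i + s j ∧ s = Pi.single i (s i) + Pi.single j (s j) := by
  have hs : s = Pi.single i (s i) + Pi.single j (s j) := by
    funext l
    rw [Pi.add_apply]
    by_cases hl : l = i
    · subst hl; simp [hij]
    · by_cases hl' : l = j
      · subst hl'; simp [hl]
      · rw [Pi.single_eq_of_ne hl, Pi.single_eq_of_ne hl']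
        by_contra h0
        exact (by simpa [hl, hl'] using (h l).1 h0 : False)
  refine ⟨?_, hs⟩
  conv_lhs => rw [hs]
  simp [Finset.sum_add_distrib]

/-- With eight points in a coordinate plane one can correct the mixed even moments of degree at
most `6`. -/
theorem exists_correction_plane {d : ℕ} (R : (Fin d → ℕ) → ℝ) (S : Finset (Fin d))
    (hS : S.card = 2) :
    ∃ C, IsMomentTable (cube d 3) 8 C ∧
      (∀ s, C s ≠ 0 → (∀ i, Even (s i)) ∧ ∀ i, s i ≠ 0 → i ∈ S) ∧
      ∀ s : Fin d → ℕ, ∑ i, s i ≤ 7 → (∀ i, Even (s i)) → (∀ i, s i ≠ 0 ↔ i ∈ S) → C s = R s := by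
  obtain ⟨i, j, hij, rfl⟩ := Finset.card_eq_two.1 hS
  have h (a b : ℝ) (ha : 0 < a) (ha' : a ≤ 3) (hb : 0 < b) (hb' : b ≤ 3) :=
    IsMomentTable.evenReflections (B := cube d 3) {i, j} (fun l => if l = i then a else b)
    (fun l _ => by split_ifs; exacts [ha.ne', hb.ne'])
    fun y => cube_of_abs_le fun l => by
      split_ifs
      exacts [(abs_of_pos ha).trans_le ha', (abs_of_pos hb).trans_le hb']
  set A := R (Pi.single i 2 + Pi.single j 2) with hA
  set B := R (Pi.single i 4 + Pi.single j 2) with hB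
  set C := R (Pi.single i 2 + Pi.single j 4) with hC
  set w := 1 + |B - A| + |C - A| with hw
  have hw0 : 0 < w := by positivity
  have key : ∀ X : ℝ, |X| < w → ∃ a, 0 < a ∧ a ≤ 3 ∧ w * a ^ 2 = w + X := by
    intro X hX
    have h1 : 0 < 1 + X / w := by
      have : -w < X := (abs_lt.1 hX).1
      have : -1 < X / w := by rw [lt_div_iff₀ hw0]; linarith
      linarith
    have h2 : X / w < 1 := by rw [div_lt_one hw0]; exact (abs_lt.1 hX).2
    refine ⟨√(1 + X / w), Real.sqrt_pos.2 h1, Real.sqrt_le_iff.2 ⟨by norm_num, by linarith⟩, ?_⟩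
    rw [Real.sq_sqrt h1.le]
    field_simp
  obtain ⟨a, ha, ha', hau⟩ := key (B - A) (by linarith [abs_nonneg (C - A)])
  obtain ⟨b, hb, hb', hbv⟩ := key (C - A) (by linarith [abs_nonneg (B - A)])
  refine ⟨_, (((h a b ha ha' hb hb').smul (w / (a ^ 2 * b ^ 2))).add
    ((h 1 1 (by norm_num) (by norm_num) (by norm_num) (by norm_num)).smul (A - w))).mono
      (by simp [Finset.card_pair hij]), fun s hs => ?_, fun s hsum he hsupp => ?_⟩
  · by_contra h
    simp only [if_neg h] at hs
    simp at hs
  · obtain ⟨h1, h2⟩ := pair_sum_eq hij hsupp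
    simp only [if_pos (show (∀ i, Even (s i)) ∧ _ from ⟨he, fun l => (hsupp l).1⟩),
      Finset.prod_pair hij, if_true, if_neg hij.symm, ite_self, one_pow, mul_one]
    have hi0 : s i ≠ 0 := (hsupp i).2 (by simp)
    have hj0 : s j ≠ 0 := (hsupp j).2 (by simp)
    have hie := he i
    have hje := he j
    rw [show R s = R (Pi.single i (s i) + Pi.single j (s j)) from congrArg R h2]
    rw [h1] at hsum
    clear h1 h2 hsupp he
    generalize s i = e at *
    generalize s j = f at *
    have : (e = 2 ∧ f = 2) ∨ (e = 4 ∧ f = 2) ∨ (e = 2 ∧ f = 4) := by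
      rcases hie with ⟨m, rfl⟩
      rcases hje with ⟨m', rfl⟩
      omega
    have ha0 := ha.ne'
    have hb0 := hb.ne'
    rcases this with ⟨rfl, rfl⟩ | ⟨rfl, rfl⟩ | ⟨rfl, rfl⟩
    · rw [← hA]; field_simp; ring
    · rw [← hB, show w / (a ^ 2 * b ^ 2) * (a ^ 4 * b ^ 2) = w * a ^ 2 by field_simp, hau]; ring
    · rw [← hC, show w / (a ^ 2 * b ^ 2) * (a ^ 2 * b ^ 4) = w * b ^ 2 by field_simp, hbv]; ring

theorem agreesFrom_of_const {d k : ℕ} {ν : Fin d → ℕ → ℝ} {κ : ℝ} (h0 : ∀ i, ν i 0 = 1)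
    (hodd : ∀ i m, Odd m → ν i m = 0) (h2 : ∀ i, ν i 2 = κ) {V : (Fin d → ℕ) → ℝ}
    (hV : ∀ s : Fin d → ℕ, ∑ i, s i ≤ 2 * k + 1 →
        ((∃ i, Odd (s i)) → V s = 0) ∧ ((∀ i, Even (s i)) → V s = 1)) :
    AgreesFrom (2 * k + 1) k (fun s => ∏ i, ν i (s i)) (fun s => κ ^ k * V s) := by
  intro s hs hor
  beta_reduce
  by_cases h : ∃ i, Odd (s i)
  · obtain ⟨i, hi⟩ := h
    rw [(hV s hs).1 ⟨i, hi⟩, Finset.prod_eq_zero (Finset.mem_univ i) (hodd i _ hi), mul_zero]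
  · have hk := hor.resolve_left h
    have he : ∀ i, Even (s i) := fun i => Nat.not_odd_iff_even.1 fun h' => h ⟨i, h'⟩
    rw [(hV s hs).2 he, mul_one]
    set P := Finset.univ.filter fun i => s i ≠ 0 with hP
    have hsum : ∑ i ∈ P, s i = ∑ i, s i := Finset.sum_filter_ne_zero _
    have hge : ∀ i ∈ P, 2 ≤ s i := fun i hi => by
      have := (Finset.mem_filter.1 hi).2
      obtain ⟨m, hm⟩ := he i
      omega
    have hcard : P.card * 2 ≤ ∑ i ∈ P, s i := Finset.card_nsmul_le_sum _ _ _ hge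
    have htwo : ∀ i ∈ P, s i = 2 := by
      intro i hi
      by_contra hne
      have h4 : 4 ≤ s i := by
        have := hge i hi
        obtain ⟨m, hm⟩ := he i
        omega
      have hsub : (P.erase i).card * 2 ≤ ∑ j ∈ P.erase i, s j :=
        Finset.card_nsmul_le_sum _ _ _ fun j hj => hge j (Finset.mem_of_mem_erase hj)
      have := Finset.add_sum_erase _ s hi
      have := Finset.card_pos.2 ⟨i, hi⟩
      rw [Finset.card_erase_of_mem hi] at hsub
      omega
    have hcard' : P.card = k := by omega
    rw [← hcard', ← Finset.prod_const, ← Finset.prod_subset (Finset.subset_univ P)]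
    · exact Finset.prod_congr rfl fun i hi => by rw [htwo i hi, h2]
    · intro i _ hi
      have : s i = 0 := by simpa [hP] using hi
      rw [this, h0]

theorem exists_table_five {d : ℕ} {ν : Fin d → ℕ → ℝ} {κ : ℝ} (h0 : ∀ i, ν i 0 = 1)
    (hodd : ∀ i m, Odd m → ν i m = 0) (h2 : ∀ i, ν i 2 = κ) :
    ∃ V, IsMomentTable (cube d 3) (d.choose 2 * 2 + (d * 2 + 2) + d * 4 + 1) V ∧
      ∀ s : Fin d → ℕ, ∑ i, s i ≤ 5 → V s = ∏ i, ν i (s i) := by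
  obtain ⟨V, hV, hV'⟩ := exists_hypercube_table_two d (c := 3) (by norm_num)
  obtain ⟨V1, hV1, hV1'⟩ := (agreesFrom_of_const (k := 2) h0 hodd h2 hV').descend
    (hV.smul _) exists_correction_axis_two
  obtain ⟨V0, hV0, hV0'⟩ := hV1'.descend hV1 exists_correction_origin
  exact ⟨V0, hV0.mono (by simp), fun s hs => hV0' s hs (Or.inr (Nat.zero_le _))⟩

theorem exists_table_seven {d : ℕ} {ν : Fin d → ℕ → ℝ} {κ : ℝ} (h0 : ∀ i, ν i 0 = 1)
    (hodd : ∀ i m, Odd m → ν i m = 0) (h2 : ∀ i, ν i 2 = κ) :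
    ∃ V, IsMomentTable (cube d 3)
        (d.choose 3 * 2 + (d.choose 2 * 2 + (d * 2 + 2)) + d.choose 2 * 8 + d * 6 + 1) V ∧
      ∀ s : Fin d → ℕ, ∑ i, s i ≤ 7 → V s = ∏ i, ν i (s i) := by
  obtain ⟨V, hV, hV'⟩ := exists_hypercube_table_three d (c := 3) (by norm_num)
  obtain ⟨V2, hV2, hV2'⟩ := (agreesFrom_of_const (k := 3) h0 hodd h2 hV').descend
    (hV.smul _) exists_correction_plane
  obtain ⟨V1, hV1, hV1'⟩ := hV2'.descend hV2 exists_correction_axis_three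
  obtain ⟨V0, hV0, hV0'⟩ := hV1'.descend hV1 exists_correction_origin
  exact ⟨V0, hV0.mono (by simp), fun s hs => hV0' s hs (Or.inr (Nat.zero_le _))⟩

namespace SymmetricProductWeight

variable {d : ℕ} (W : SymmetricProductWeight d)

/-- The one-dimensional moments `∫ x ^ m ρᵢ(x) dx`. -/
noncomputable def moment (i : Fin d) (m : ℕ) : ℝ := ∫ x in W.dom i, x ^ m * W.weight i x

theorem restrict_domain :
    (volume : Measure (Fin d → ℝ)).restrict W.domain
      = Measure.pi fun i => (volume : Measure ℝ).restrict (W.dom i) := by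
  rw [← Measure.restrict_pi_pi, ← volume_pi]
  congr 1
  ext x
  simp [domain]

theorem integrableOn_monomial (s : Fin d → ℕ) :
    IntegrableOn (fun x => (∏ i, x i ^ s i) * W.density x) W.domain := by
  simp only [density, ← Finset.prod_mul_distrib, IntegrableOn, restrict_domain]
  exact Integrable.fintype_prod fun i => W.weight_integrable i (s i)

theorem integral_monomial (s : Fin d → ℕ) :
    W.integral (fun x => ∏ i, x i ^ s i) = ∏ i, W.moment i (s i) := by
  simp only [integral, density, ← Finset.prod_mul_distrib, restrict_domain]
  exact integral_fintype_prod_eq_prod (fun i x => x ^ s i * W.weight i x)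

theorem integral_eval (p : MvPolynomial (Fin d) ℝ) :
    W.integral (fun x => MvPolynomial.eval x p)
      = ∑ s ∈ p.support, p.coeff s * ∏ i, W.moment i (s i) := by
  simp only [← integral_monomial, integral, MvPolynomial.eval_eq', Finset.sum_mul]
  rw [integral_finsetSum]
  · refine Finset.sum_congr rfl fun s _ => ?_
    rw [← integral_const_mul]
    simp only [mul_assoc]
  · intro s _
    simpa only [mul_assoc] using (W.integrableOn_monomial s).const_mul (p.coeff s)

theorem moment_odd (i : Fin d) {m : ℕ} (hm : Odd m) : W.moment i m = 0 := by
  have hmeas := (W.dom_interval i).measurableSet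
  have h : ∀ x, (W.dom i).indicator (fun x => x ^ m * W.weight i x) (-x)
      = -(W.dom i).indicator (fun x => x ^ m * W.weight i x) x := by
    intro x
    by_cases hx : x ∈ W.dom i
    · rw [Set.indicator_of_mem hx, Set.indicator_of_mem (W.dom_symm i x hx), hm.neg_pow,
        W.weight_symm i x hx]
      ring
    · rw [Set.indicator_of_notMem hx, Set.indicator_of_notMem, neg_zero]
      exact fun h => hx (by simpa using W.dom_symm i _ h)
  have := integral_neg_eq_self ((W.dom i).indicator fun x => x ^ m * W.weight i x) volume
  simp only [h, integral_neg, integral_indicator hmeas] at this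
  unfold moment
  linarith

theorem moment_even_nonneg (i : Fin d) {m : ℕ} (hm : Even m) : 0 ≤ W.moment i m :=
  setIntegral_nonneg (W.dom_interval i).measurableSet fun x hx =>
    mul_nonneg (hm.pow_nonneg x) (W.weight_nonneg i x hx)

theorem moment_eq_zero (i : Fin d) {e : ℕ} (he : Even e) (h : W.moment i e = 0) (m : ℕ) :
    W.moment i m = 0 := by
  have hmeas := (W.dom_interval i).measurableSet
  unfold moment at h
  rw [setIntegral_eq_zero_iff_of_nonneg_ae _ (W.weight_integrable i e)] at h
  · refine integral_eq_zero_of_ae ?_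
    have h0 : ∀ᵐ x ∂(volume : Measure ℝ).restrict (W.dom i), x ≠ 0 :=
      ae_restrict_of_ae (by simp [ae_iff])
    filter_upwards [h, h0] with x hx hx0
    have : W.weight i x = 0 := by simpa [hx0] using hx
    simp [this]
  · filter_upwards [ae_restrict_mem hmeas] with x hx
    exact mul_nonneg (he.pow_nonneg x) (W.weight_nonneg i x hx)

theorem exists_pos_Icc_subset (i : Fin d) (h : W.moment i 0 ≠ 0) :
    ∃ t : ℝ, 0 < t ∧ ∀ x, |x| ≤ t → x ∈ W.dom i := by
  by_cases hne : ∃ x ∈ W.dom i, x ≠ 0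
  · obtain ⟨x, hx, hx0⟩ := hne
    refine ⟨|x|, abs_pos.2 hx0, fun y hy => ?_⟩
    have h1 : |x| ∈ W.dom i := by
      rcases abs_choice x with h | h <;> rw [h]
      exacts [hx, W.dom_symm i x hx]
    exact (W.dom_interval i).out (W.dom_symm i _ h1) h1 (abs_le.1 hy)
  · push Not at hne
    refine absurd ?_ h
    refine setIntegral_measure_zero _ (measure_mono_null (t := {0}) ?_ (by simp))
    exact fun x hx => hne x hx

end SymmetricProductWeight

/-- A construction of moment tables for normalised moments yields cubature formulas. -/
theorem SymmetricProductWeight.exists_cubature {d : ℕ} (W : SymmetricProductWeight d) (D N : ℕ)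
    (H : ∀ (ν : Fin d → ℕ → ℝ) (κ : ℝ), (∀ i, ν i 0 = 1) → (∀ i m, Odd m → ν i m = 0) →
      (∀ i, ν i 2 = κ) → ∃ V, IsMomentTable (cube d 3) N V ∧
        ∀ s : Fin d → ℕ, ∑ i, s i ≤ D → V s = ∏ i, ν i (s i)) :
    ∃ n : ℕ, n ≤ N ∧ ∃ Q : CubatureFormula W.domain n, Q.HasExactness D := by
  by_cases hdeg : ∃ i, W.moment i 2 = 0
  · obtain ⟨i, hi⟩ := hdeg
    refine ⟨0, Nat.zero_le _, ⟨Fin.elim0, fun i => i.elim0, fun i => i.elim0⟩, fun p _ => ?_⟩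
    rw [W.integral_eval, Finset.sum_eq_zero]
    · simp [CubatureFormula.apply]
    · intro s _
      rw [Finset.prod_eq_zero (Finset.mem_univ i) (W.moment_eq_zero i even_two hi _), mul_zero]
  push Not at hdeg
  have h2 : ∀ i, 0 < W.moment i 2 := fun i =>
    lt_of_le_of_ne (W.moment_even_nonneg i even_two) (hdeg i).symm
  have h0' : ∀ i, W.moment i 0 ≠ 0 := fun i h => hdeg i (W.moment_eq_zero i Even.zero h 2)
  have h0 : ∀ i, 0 < W.moment i 0 := fun i =>
    lt_of_le_of_ne (W.moment_even_nonneg i Even.zero) (h0' i).symm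
  choose τ hτ hτdom using fun i => W.exists_pos_Icc_subset i (h0' i)
  set σ : Fin d → ℝ := fun i => √(W.moment i 2 / W.moment i 0) with hσ
  have hσ0 : ∀ i, 0 < σ i := fun i => Real.sqrt_pos.2 (div_pos (h2 i) (h0 i))
  obtain ⟨r, hr, hr0⟩ : ∃ r : ℝ, (∀ i, r ≤ τ i / (3 * σ i)) ∧ 0 < r := by
    have h1 : ∀ᶠ r in nhdsWithin (0 : ℝ) (Set.Ioi 0), ∀ i, r ≤ τ i / (3 * σ i) :=
      Filter.eventually_all.2 fun i => nhdsWithin_le_nhds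
        (Iic_mem_nhds (div_pos (hτ i) (mul_pos three_pos (hσ0 i))))
    exact (h1.and self_mem_nhdsWithin).exists
  set t : Fin d → ℝ := fun i => r * σ i with ht
  have ht0 : ∀ i, 0 < t i := fun i => mul_pos hr0 (hσ0 i)
  obtain ⟨V, ⟨ι, hι, w, y, hcard, hy, hVy⟩, hV⟩ := H
    (fun i m => W.moment i m / (W.moment i 0 * t i ^ m)) (1 / r ^ 2)
    (fun i => by simp [h0' i]) (fun i m hm => by rw [W.moment_odd i hm, zero_div])
    (fun i => by
      have := h0' i
      have := hdeg i
      rw [ht, mul_pow, hσ, Real.sq_sqrt (div_pos (h2 i) (h0 i)).le]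
      field_simp)
  have hmem : ∀ a, (fun j => t j * y a j) ∈ W.domain := fun a j => hτdom j _ <| by
    have h3 := (le_div_iff₀ (mul_pos three_pos (hσ0 j))).1 (hr j)
    rw [abs_mul, abs_of_pos (ht0 j)]
    calc t j * |y a j| ≤ t j * 3 := mul_le_mul_of_nonneg_left (hy a j) (ht0 j).le
      _ = r * (3 * σ j) := by rw [ht]; ring
      _ ≤ τ j := h3
  let e := Fintype.equivFin ι
  refine ⟨Fintype.card ι, hcard, ⟨fun a => (∏ j, W.moment j 0) * w (e.symm a),
    fun a j => t j * y (e.symm a) j, fun a => hmem _⟩, fun p hp => ?_⟩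
  rw [W.integral_eval, CubatureFormula.apply]
  rw [e.symm.sum_comp fun a => (∏ j, W.moment j 0) * w a *
    MvPolynomial.eval (fun j => t j * y a j) p]
  simp only [MvPolynomial.eval_eq', Finset.mul_sum]
  rw [Finset.sum_comm]
  refine Finset.sum_congr rfl fun s hs => ?_
  have hsum : ∑ i, s i ≤ D := by
    have := (MvPolynomial.le_totalDegree hs).trans hp
    rwa [Finsupp.sum_fintype _ _ fun _ => rfl] at this
  have hkey : ∏ i, W.moment i (s i) = (∏ j, W.moment j 0) * (∏ j, t j ^ s j) * V s := by
    rw [hV s hsum, ← Finset.prod_mul_distrib, ← Finset.prod_mul_distrib]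
    refine Finset.prod_congr rfl fun i _ => ?_
    have := h0' i
    have := (ht0 i).ne'
    field_simp
  rw [hkey, hVy, Finset.mul_sum, Finset.mul_sum]
  refine Finset.sum_congr rfl fun a _ => ?_
  simp only [mul_pow, Finset.prod_mul_distrib]
  ring

theorem cast_choose_three (d : ℕ) : (d.choose 3 : ℝ) = d * (d - 1) * (d - 2) / 6 := by
  induction d with
  | zero => simp
  | succ d ih =>
    rw [Nat.choose_succ_succ' d 2, Nat.cast_add, ih, Nat.cast_choose_two]
    push_cast
    ring

theorem SymmetricProductWeight.exists_cubature_five {d : ℕ} (W : SymmetricProductWeight d) :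
    ∃ n : ℕ, (n : ℝ) ≤ (d : ℝ) ^ 2 + 5 * d + 3 ∧
      ∃ Q : CubatureFormula W.domain n, Q.HasExactness (2 * 2 + 1) := by
  obtain ⟨n, hn, hQ⟩ := W.exists_cubature (2 * 2 + 1) _ fun _ _ => exists_table_five
  refine ⟨n, (Nat.cast_le.2 hn).trans (le_of_eq ?_), hQ⟩
  push_cast [Nat.cast_choose_two]
  ring

theorem SymmetricProductWeight.exists_cubature_seven {d : ℕ} (W : SymmetricProductWeight d) :
    ∃ n : ℕ, (n : ℝ) ≤ ((d : ℝ) ^ 3 + 12 * (d : ℝ) ^ 2 + 11 * d + 9) / 3 ∧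
      ∃ Q : CubatureFormula W.domain n, Q.HasExactness (2 * 3 + 1) := by
  obtain ⟨n, hn, hQ⟩ := W.exists_cubature (2 * 3 + 1) _ fun _ _ => exists_table_seven
  refine ⟨n, (Nat.cast_le.2 hn).trans (le_of_eq ?_), hQ⟩
  push_cast [Nat.cast_choose_two, cast_choose_three]
  ring

theorem theorem1 (d : ℕ) (W : SymmetricProductWeight d) :
    (4 ≤ d →
      (∃ n : ℕ, (n : ℝ) ≤ (d : ℝ) ^ 2 + 9 * d + 1 ∧
        ∃ Q : CubatureFormula W.domain n, Q.HasExactness (2 * 2 + 1)) ∧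
      (W.FullySymmetric →
        ∃ n : ℕ, (n : ℝ) ≤ (d : ℝ) ^ 2 + 7 * d + 1 ∧
          ∃ Q : CubatureFormula W.domain n, Q.HasExactness (2 * 2 + 1))) ∧
    (6 ≤ d →
      (∃ n : ℕ, (n : ℝ) ≤ ((d : ℝ) ^ 3 + 33 * (d : ℝ) ^ 2 + 14 * d + 3) / 3 ∧
        ∃ Q : CubatureFormula W.domain n, Q.HasExactness (2 * 3 + 1)) ∧
      (W.FullySymmetric →
        ∃ n : ℕ, (n : ℝ) ≤ ((d : ℝ) ^ 3 + 21 * (d : ℝ) ^ 2 + 20 * d + 3) / 3 ∧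
          ∃ Q : CubatureFormula W.domain n, Q.HasExactness (2 * 3 + 1))) := by
  refine ⟨fun hd => ?_, fun hd => ?_⟩
  · have hd' : (4 : ℝ) ≤ d := by exact_mod_cast hd
    obtain ⟨n, hn, hQ⟩ := W.exists_cubature_five
    exact ⟨⟨n, by linarith, hQ⟩, fun _ => ⟨n, by linarith, hQ⟩⟩
  · have hd' : (6 : ℝ) ≤ d := by exact_mod_cast hd
    obtain ⟨n, hn, hQ⟩ := W.exists_cubature_seven
    exact ⟨⟨n, by nlinarith, hQ⟩, fun _ => ⟨n, by nlinarith, hQ⟩⟩
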